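/- A weight is a non-negative, locally integrable function $w$ on $\mathbb R$; write $w(a,b)=\int_a^b w$ and $$\mathsf M^-f(x)=\sup_{h>0}\frac1h\int_{x-h}^x|f(t)|\,dt .$$ Define the (Fujii–Wilson) $A_\infty^+$ constant of $w$ and, for $1<p<\infty$ and $\sigma=w^{-1/(p-1)}$, its $A_p^+$ constant by $$[w]_{A_\infty^+}=\sup_{a<b}\frac1{w(a,b)}\int_a^b\mathsf M^-(w\mathbf 1_{(a,b)})(x)\,dx,\qquad [w]_{A_p^+}=\sup_{a<b<c}\frac{w(a,b)}{c-a}\Big(\frac{1}{c-a}\int_b^c\sigma\Big)^{p-1},$$ with the conventions $0/0=0$, $0\cdot\infty=0$ and $\sigma=\infty$ where $w=0$. Let $A_\infty^+$ (respectively $A_p^+$) be the class of all weights $w$ with $[w]_{A_\infty^+}<\infty$ (respectively $[w]_{A_p^+}<\infty$). There is a numerical constant $c>0$ such that, for every $w\in A_\infty^+$ and every $p>e^{c[w]_{A_\infty^+}}$, one has $w\in A_p^+$ and $$[w]_{A_p^+}\le\exp\big(\exp(c[w]_{A_\infty^+})\big).$$ -/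

import Mathlib

open MeasureTheory Set
open scoped ENNReal

noncomputable section

namespace OneSided

/-- A weight on the real line: a non-negative, locally integrable function. -/
structure IsWeight (w : ℝ → ℝ) : Prop where
  nonneg : ∀ x, 0 ≤ w x
  locallyIntegrable : LocallyIntegrable w volume

/-- The backward one-sided Hardy-Littlewood maximal function
`M⁻ f (x) = sup_{h > 0} (1 / h) ∫_{x - h}^{x} |f|`, with values in `[0, ∞]`. -/
def maximalMinus (f : ℝ → ℝ) (x : ℝ) : ℝ≥0∞ :=
  ⨆ (h : ℝ) (_ : 0 < h), (∫⁻ t in Ioo (x - h) x, ENNReal.ofReal |f t|) / ENNReal.ofReal h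

/-- The mass `w(a, b) = ∫_{(a, b)} w`. -/
def mass (w : ℝ → ℝ) (a b : ℝ) : ℝ≥0∞ :=
  ∫⁻ t in Ioo a b, ENNReal.ofReal (w t)

/-- The Fujii-Wilson constant
`[w]_{A_∞⁺} = sup_{a < b} (1 / w(a, b)) ∫_{(a, b)} M⁻(w 1_{(a, b)})`, with values in `[0, ∞]`.
If `w(a, b) = 0`, then the integral vanishes too and the quotient is `0 / 0 = 0`, so that
such intervals impose no condition. -/
def aInftyPlusConst (w : ℝ → ℝ) : ℝ≥0∞ :=
  ⨆ (a : ℝ) (b : ℝ) (_ : a < b),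
    (∫⁻ x in Ioo a b, maximalMinus ((Ioo a b).indicator w) x) / mass w a b

/-- The class `A_∞⁺`. -/
def AInftyPlus : Set (ℝ → ℝ) :=
  {w | IsWeight w ∧ aInftyPlusConst w < ∞}

/-- The dual weight `σ = w ^ (-1 / (p - 1))`, with values in `[0, ∞]`; it is `∞` where `w = 0`
(for `1 < p`). -/
def dualWeight (p : ℝ) (w : ℝ → ℝ) (t : ℝ) : ℝ≥0∞ :=
  ENNReal.ofReal (w t) ^ (-(1 / (p - 1)))

/-- The constant, for `1 < p`,
`[w]_{A_p⁺} = sup_{a < b < c} (w(a, b) / |(a, c)|) (σ(b, c) / |(a, c)|) ^ (p - 1)`,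
with values in `[0, ∞]` and with the usual convention `0 * ∞ = 0`. -/
def apPlusConst (p : ℝ) (w : ℝ → ℝ) : ℝ≥0∞ :=
  ⨆ (a : ℝ) (b : ℝ) (c : ℝ) (_ : a < b) (_ : b < c),
    (mass w a b / ENNReal.ofReal (c - a)) *
      ((∫⁻ t in Ioo b c, dualWeight p w t) / ENNReal.ofReal (c - a)) ^ (p - 1)

/-- The class `A_p⁺`, for `1 < p`. -/
def APPlus (p : ℝ) : Set (ℝ → ℝ) :=
  {w | IsWeight w ∧ apPlusConst p w < ∞}

end OneSided

end

namespace OneSided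

/-! Let `F` be a primitive of `w`, `ν = w dx` and `C` the Fujii–Wilson constant, which is at least
`1` unless `w` vanishes almost everywhere. The proof turns the condition into geometric decay of the
sets where forward averages are small, then integrates a small negative power of `w`.

Absolute continuity (`FujiiWilson.measure_le`): between `b` and `c` there is a point `x` whose
backward averages down to `a` are at most `l`, a multiple of `C ν(a,c)/(c-b)`. The sets of `(a,x)`
where some backward average exceeds `2^j l` have small `ν`-measure: summing over `j ≤ n` and
applying the condition on each component gives `(n+1) ν(U_n) ≤ 2C ν(a,x)`. Off `U_n` one has `w ≤
2^n l`, so for `n` of size `8C` a set of small length in `(a,b)` carries little more than a quarter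
of `ν(a,c)`.

Decay (`FujiiWilson.volume_lowerLevel_le`): by the rising sun lemma, components of the set where
some forward average is below `l` have mean exactly `l`, provided the forward averages at the left
end are at least `l`. By absolute continuity, the level `l/4` misses a fraction at least `δ =
1/(2^(n+5) C)` of each component; iterating gives the factor `(1-δ)^k` at level `l/4^k`.

Conclusion (`mass_mul_rpow_le`): starting from a good point of `(a,b)`, the layers give a bound for
the integral of `w^(-δ/8)` over `(b,c)`. Jensen's inequality passes to any `p ≥ 1 + 8/δ`, and `1/δ`
is exponential in `C`. -/

/-! ### Components of bounded open subsets of the line -/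

/-- The connected components of an open subset of the line with finite endpoints, encoded by
their pairs of endpoints. -/
def components (U : Set ℝ) : Set (ℝ × ℝ) :=
  {q | q.1 < q.2 ∧ Ioo q.1 q.2 ⊆ U ∧ q.1 ∉ U ∧ q.2 ∉ U}

lemma components_pairwiseDisjoint (U : Set ℝ) :
    (components U).PairwiseDisjoint (fun q => Ioo q.1 q.2) := by
  rintro ⟨a, b⟩ ⟨hab, hU, ha, hb⟩ ⟨c, d⟩ ⟨hcd, hV, hc, hd⟩ hne
  simp only at *
  refine Set.disjoint_left.2 fun x hx hy => hne ?_
  have h1 : a = c := by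
    rcases lt_trichotomy a c with h | h | h
    · exact absurd (hU ⟨h, hy.1.trans hx.2⟩) hc
    · exact h
    · exact absurd (hV ⟨h, hx.1.trans hy.2⟩) ha
  have h2 : b = d := by
    rcases lt_trichotomy b d with h | h | h
    · exact absurd (hV ⟨hy.1.trans hx.2, h⟩) hb
    · exact h
    · exact absurd (hU ⟨hx.1.trans hy.2, h⟩) hd
  rw [h1, h2]

lemma components_countable (U : Set ℝ) : (components U).Countable :=
  (components_pairwiseDisjoint U).countable_of_isOpen (fun _ _ => isOpen_Ioo)
    (fun _ hq => nonempty_Ioo.2 hq.1)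

lemma exists_component_of_mem {U : Set ℝ} (hU : IsOpen U) {a b : ℝ} (hab : U ⊆ Ioo a b)
    {x : ℝ} (hx : x ∈ U) : ∃ q ∈ components U, x ∈ Ioo q.1 q.2 := by
  have hxab := hab hx
  have ha : a ∉ U := fun h => lt_irrefl a (hab h).1
  have hb : b ∉ U := fun h => lt_irrefl b (hab h).2
  have hK1 : IsCompact (Icc a x \ U) := isCompact_Icc.diff hU
  have hK2 : IsCompact (Icc x b \ U) := isCompact_Icc.diff hU
  obtain ⟨α, hα, hα'⟩ := hK1.exists_isGreatest ⟨a, ⟨le_rfl, hxab.1.le⟩, ha⟩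
  obtain ⟨β, hβ, hβ'⟩ := hK2.exists_isLeast ⟨b, ⟨hxab.2.le, le_rfl⟩, hb⟩
  have h1 : α < x := lt_of_le_of_ne hα.1.2 fun h => hα.2 (h ▸ hx)
  have h2 : x < β := lt_of_le_of_ne hβ.1.1 fun h => hβ.2 (h ▸ hx)
  refine ⟨(α, β), ⟨h1.trans h2, fun y hy => ?_, hα.2, hβ.2⟩, h1, h2⟩
  by_contra hyU
  rcases le_total y x with h | h
  · exact absurd (hα' ⟨⟨hα.1.1.trans hy.1.le, h⟩, hyU⟩) (not_le.2 hy.1)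
  · exact absurd (hβ' ⟨⟨h, hy.2.le.trans hβ.1.2⟩, hyU⟩) (not_le.2 hy.2)

lemma biUnion_components {U : Set ℝ} (hU : IsOpen U) {a b : ℝ} (hab : U ⊆ Ioo a b) :
    ⋃ q ∈ components U, Ioo q.1 q.2 = U := by
  ext x
  simp only [mem_iUnion, exists_prop]
  exact ⟨fun ⟨q, hq, hx⟩ => hq.2.1 hx, fun hx => exists_component_of_mem hU hab hx⟩

/-- All level set estimates below are reduced through this lemma to a single component, whose
endpoints lie outside the set. -/
lemma measure_le_of_components {μ ν : Measure ℝ} {U : Set ℝ} (hU : IsOpen U) {a b : ℝ}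
    (hab : U ⊆ Ioo a b)
    (h : ∀ α β, α < β → Ioo α β ⊆ U → α ∉ U → β ∉ U → μ (Ioo α β) ≤ ν (Ioo α β)) :
    μ U ≤ ν U := by
  rw [← biUnion_components hU hab,
    measure_biUnion (components_countable U) (components_pairwiseDisjoint U)
      (fun _ _ => measurableSet_Ioo),
    measure_biUnion (components_countable U) (components_pairwiseDisjoint U)
      (fun _ _ => measurableSet_Ioo)]
  exact ENNReal.tsum_le_tsum fun q => h _ _ q.2.1 q.2.2.1 q.2.2.2.1 q.2.2.2.2

/-- A component of a subset of `(a, b)` has its endpoints in `[a, b]`. -/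
lemma le_and_le_of_Ioo_subset {α β a b : ℝ} {U : Set ℝ} (hαβ : α < β) (h : Ioo α β ⊆ U)
    (hU : U ⊆ Ioo a b) : a ≤ α ∧ β ≤ b :=
  (Ioo_subset_Ioo_iff hαβ).1 (h.trans hU)

/-! ### One-sided level sets and the rising sun lemma -/

/-- `F` is a continuous distribution function of the measure `ν`. -/
structure IsDistribution (ν : Measure ℝ) (F : ℝ → ℝ) : Prop where
  continuous : Continuous F
  monotone : Monotone F
  measure_Ioo : ∀ s t, s ≤ t → ν (Ioo s t) = ENNReal.ofReal (F t - F s)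

/-- The points of `(b, c)` from which some forward average of `dF` is below `l`. -/
def lowerLevel (F : ℝ → ℝ) (l b c : ℝ) : Set ℝ :=
  {x ∈ Ioo b c | ∃ y ∈ Ioc x c, F y - F x < l * (y - x)}

/-- The points of `(a, b)` at which some backward average of `dF` is above `l`. -/
def upperLevel (F : ℝ → ℝ) (l a b : ℝ) : Set ℝ :=
  {x ∈ Ioo a b | ∃ s ∈ Ico a x, l * (x - s) < F x - F s}

variable {ν : Measure ℝ} {F : ℝ → ℝ}

lemma lowerLevel_subset (F : ℝ → ℝ) (l b c : ℝ) : lowerLevel F l b c ⊆ Ioo b c := fun _ h => h.1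

lemma upperLevel_subset (F : ℝ → ℝ) (l a b : ℝ) : upperLevel F l a b ⊆ Ioo a b := fun _ h => h.1

lemma isOpen_lowerLevel (hF : Continuous F) (l b c : ℝ) : IsOpen (lowerLevel F l b c) := by
  have : lowerLevel F l b c =
      ⋃ y ∈ Iic c, Ioo b c ∩ Iio y ∩ {x | F y - F x < l * (y - x)} := by
    ext x
    simp only [lowerLevel, mem_ofPred_eq, mem_iUnion, mem_inter_iff, mem_Iio, mem_Iic, mem_Ioc,
      exists_prop]
    constructor
    · rintro ⟨hx, y, ⟨h1, h2⟩, h3⟩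
      exact ⟨y, h2, ⟨hx, h1⟩, h3⟩
    · rintro ⟨y, h2, ⟨hx, h1⟩, h3⟩
      exact ⟨hx, y, ⟨h1, h2⟩, h3⟩
  rw [this]
  exact isOpen_biUnion fun y _ => (isOpen_Ioo.inter isOpen_Iio).inter
    (isOpen_lt (by fun_prop) (by fun_prop))

lemma isOpen_upperLevel (hF : Continuous F) (l a b : ℝ) : IsOpen (upperLevel F l a b) := by
  have : upperLevel F l a b =
      ⋃ s ∈ Ici a, Ioo a b ∩ Ioi s ∩ {x | l * (x - s) < F x - F s} := by
    ext x
    simp only [upperLevel, mem_ofPred_eq, mem_iUnion, mem_inter_iff, mem_Ioi, mem_Ici, mem_Ico,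
      exists_prop]
    constructor
    · rintro ⟨hx, y, ⟨h1, h2⟩, h3⟩
      exact ⟨y, h1, ⟨hx, h2⟩, h3⟩
    · rintro ⟨y, h2, ⟨hx, h1⟩, h3⟩
      exact ⟨hx, y, ⟨h2, h1⟩, h3⟩
  rw [this]
  exact isOpen_biUnion fun y _ => (isOpen_Ioo.inter isOpen_Ioi).inter
    (isOpen_lt (by fun_prop) (by fun_prop))

lemma lowerLevel_mono (F : ℝ → ℝ) {l l' : ℝ} (h : l ≤ l') (b c : ℝ) :
    lowerLevel F l b c ⊆ lowerLevel F l' b c := by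
  rintro x ⟨hx, y, hy, hlt⟩
  exact ⟨hx, y, hy, hlt.trans_le (mul_le_mul_of_nonneg_right h (sub_nonneg.2 hy.1.le))⟩

lemma upperLevel_anti (F : ℝ → ℝ) {l l' : ℝ} (h : l ≤ l') (a b : ℝ) :
    upperLevel F l' a b ⊆ upperLevel F l a b := by
  rintro x ⟨hx, y, hy, hlt⟩
  exact ⟨hx, y, hy, (mul_le_mul_of_nonneg_right h (sub_nonneg.2 hy.2.le)).trans_lt hlt⟩

lemma smul_volume_Ioo {l : ℝ} (hl : 0 ≤ l) (α β : ℝ) :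
    (ENNReal.ofReal l • (volume : Measure ℝ)) (Ioo α β) = ENNReal.ofReal (l * (β - α)) := by
  rw [Measure.smul_apply, Real.volume_Ioo, smul_eq_mul, ENNReal.ofReal_mul hl]

/-- The right endpoint of a component is not in the set, so its backward averages are at most `l`.
The endpoint `b` is excluded by definition, hence the separate hypothesis there. -/
lemma IsDistribution.measure_upperLevel_le (hF : IsDistribution ν F) {l a b : ℝ} (hl : 0 ≤ l)
    (hb : ∀ s ∈ Ico a b, F b - F s ≤ l * (b - s)) :
    ν (upperLevel F l a b) ≤ ENNReal.ofReal l * volume (upperLevel F l a b) := by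
  have := measure_le_of_components (μ := ν) (ν := ENNReal.ofReal l • (volume : Measure ℝ))
    (isOpen_upperLevel hF.continuous l a b) (upperLevel_subset F l a b)
    fun α β hαβ hsub hα hβ => ?_
  · simpa using this
  obtain ⟨h1, h2⟩ := le_and_le_of_Ioo_subset hαβ hsub (upperLevel_subset F l a b)
  rw [smul_volume_Ioo hl, hF.measure_Ioo _ _ hαβ.le]
  refine ENNReal.ofReal_le_ofReal ?_
  rcases h2.eq_or_lt with rfl | h2
  · exact hb α ⟨h1, hαβ⟩
  · by_contra! hlt
    exact hβ ⟨⟨h1.trans_lt hαβ, h2⟩, α, ⟨h1, hαβ⟩, hlt⟩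

/-- Rising sun property of the components of a lower level set. -/
lemma le_of_mem_component_lowerLevel (hF : Continuous F) {l b c α β x : ℝ} (hαβ : α < β)
    (hsub : Ioo α β ⊆ lowerLevel F l b c) (hβ : β ∉ lowerLevel F l b c)
    (hx : x ∈ Icc α β) : F β - F x ≤ l * (β - x) := by
  obtain ⟨hbα, hβc⟩ := le_and_le_of_Ioo_subset hαβ hsub (lowerLevel_subset F l b c)
  have key : ∀ x ∈ Ioo α β, F β - l * β ≤ F x - l * x := by
    intro x hx
    -- A minimiser `z < β` of `F t - l t` on `[x, β]` would lie in the level set. Its witness `y`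
    -- then falls beyond `β`, which would put `β` in the set as well.
    obtain ⟨z, hz, hmin⟩ := isCompact_Icc.exists_isMinOn (nonempty_Icc.2 hx.2.le)
      (show ContinuousOn (fun t => F t - l * t) (Icc x β) by fun_prop)
    have hmin' : ∀ t ∈ Icc x β, F z - l * z ≤ F t - l * t := fun t ht => hmin ht
    rcases hz.2.eq_or_lt with rfl | hzβ
    · exact hmin' x ⟨le_rfl, hx.2.le⟩
    obtain ⟨-, y, hy, hlt⟩ := hsub ⟨hx.1.trans_le hz.1, hzβ⟩
    have hyβ : β < y := by
      by_contra! h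
      have := hmin' y ⟨hz.1.trans hy.1.le, h⟩
      linarith
    have h1 : ¬ F y - F β < l * (y - β) := fun h =>
      hβ ⟨⟨hbα.trans_lt hαβ, hyβ.trans_le hy.2⟩, y, ⟨hyβ, hy.2⟩, h⟩
    have h2 := hmin' β ⟨hz.1.trans hzβ.le, le_rfl⟩
    exfalso
    linarith
  have hcl : Icc α β ⊆ {x | F β - l * β ≤ F x - l * x} := by
    rw [← closure_Ioo hαβ.ne]
    exact closure_minimal key (isClosed_le (by fun_prop) (by fun_prop))
  have := hcl hx
  simp only [mem_ofPred_eq] at this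
  linarith

lemma IsDistribution.measure_lowerLevel_le (hF : IsDistribution ν F) {l : ℝ} (hl : 0 ≤ l)
    (b c : ℝ) : ν (lowerLevel F l b c) ≤ ENNReal.ofReal l * volume (lowerLevel F l b c) := by
  have := measure_le_of_components (μ := ν) (ν := ENNReal.ofReal l • (volume : Measure ℝ))
    (isOpen_lowerLevel hF.continuous l b c) (lowerLevel_subset F l b c)
    fun α β hαβ hsub hα hβ => ?_
  · simpa using this
  rw [smul_volume_Ioo hl, hF.measure_Ioo _ _ hαβ.le]
  exact ENNReal.ofReal_le_ofReal
    (le_of_mem_component_lowerLevel hF.continuous hαβ hsub hβ ⟨le_rfl, hαβ.le⟩)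

/-- On an interval whose right endpoint lies outside the lower level set, the lower level set
is the one of the interval. -/
lemma lowerLevel_inter_Ioo {l b c α β : ℝ} (hbα : b ≤ α) (hβc : β ≤ c) (hαβ : α < β)
    (hβ : β ∉ lowerLevel F l b c) :
    lowerLevel F l b c ∩ Ioo α β = lowerLevel F l α β := by
  ext x
  constructor
  · rintro ⟨⟨-, y, hy, hlt⟩, hx⟩
    refine ⟨hx, ?_⟩
    rcases le_or_gt y β with h | h
    · exact ⟨y, ⟨hy.1, h⟩, hlt⟩
    -- The average over `(β, y)` is at least `l`, so cutting `(x, y)` at `β` keeps the average below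
    -- `l`.
    · have h1 : ¬ F y - F β < l * (y - β) := fun h' =>
        hβ ⟨⟨hbα.trans_lt hαβ, h.trans_le hy.2⟩, y, ⟨h, hy.2⟩, h'⟩
      exact ⟨β, ⟨hx.2, le_rfl⟩, by linarith⟩
  · rintro ⟨hx, y, hy, hlt⟩
    exact ⟨⟨⟨hbα.trans_lt hx.1, hx.2.trans_le hβc⟩, y, ⟨hy.1, hy.2.trans hβc⟩, hlt⟩, hx⟩

/-! ### The Fujii–Wilson condition and upper level sets -/

/-- The supremum of the backward averages of `dF` over the intervals `(s, x)` with `a ≤ s`. -/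
noncomputable def backwardSup (F : ℝ → ℝ) (a x : ℝ) : ℝ≥0∞ :=
  ⨆ s ∈ Ico a x, ENNReal.ofReal ((F x - F s) / (x - s))

lemma ofReal_le_backwardSup {a x l : ℝ} (h : ∃ s ∈ Ico a x, l * (x - s) < F x - F s) :
    ENNReal.ofReal l ≤ backwardSup F a x := by
  obtain ⟨s, hs, hlt⟩ := h
  refine le_trans (ENNReal.ofReal_le_ofReal ?_) (le_iSup₂ (f := fun s (_ : s ∈ Ico a x) =>
    ENNReal.ofReal ((F x - F s) / (x - s))) s hs)
  rw [le_div_iff₀ (sub_pos.2 hs.2)]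
  exact hlt.le

/-- Starting left of `α` never helps: the average over `(s, α)` is at most `l`. Hence either `(α,
x)` does at least as well as `(s, x)`, or the average over `(s, x)` is below `l` and loses to the
interval witnessing that `x` is in the level set. -/
lemma backwardSup_le_of_component {l a b α β x : ℝ} (hβb : β ≤ b)
    (hsub : Ioo α β ⊆ upperLevel F l a b) (hα : α ∉ upperLevel F l a b) (hx : x ∈ Ioo α β) :
    backwardSup F a x ≤ backwardSup F α x := by
  refine iSup₂_le fun s hs => ?_
  suffices ∃ t ∈ Ico α x, (F x - F s) / (x - s) ≤ (F x - F t) / (x - t) by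
    obtain ⟨t, ht, hle⟩ := this
    exact le_trans (ENNReal.ofReal_le_ofReal hle) (le_iSup₂ (f := fun s (_ : s ∈ Ico α x) =>
      ENNReal.ofReal ((F x - F s) / (x - s))) t ht)
  rcases le_or_gt α s with h | h
  · exact ⟨s, ⟨h, hs.2⟩, le_rfl⟩
  have hout : ∀ r, a ≤ r → r < α → F α - F r ≤ l * (α - r) := fun r har hr => by
    by_contra! hlt
    exact hα ⟨⟨har.trans_lt hr, hx.1.trans (hx.2.trans_le hβb)⟩, r, ⟨har, hr⟩, hlt⟩
  have hsl := hout s hs.1 h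
  have hxs : 0 < x - s := sub_pos.2 hs.2
  have hxα : 0 < x - α := sub_pos.2 hx.1
  rcases le_or_gt (l * (x - α)) (F x - F α) with hc | hc
  · refine ⟨α, ⟨le_rfl, hx.1⟩, ?_⟩
    rw [div_le_div_iff₀ hxs hxα]
    have h1 : (F α - F s) * (x - α) ≤ l * (α - s) * (x - α) :=
      mul_le_mul_of_nonneg_right hsl hxα.le
    have h2 : l * (x - α) * (α - s) ≤ (F x - F α) * (α - s) :=
      mul_le_mul_of_nonneg_right hc (sub_pos.2 h).le
    nlinarith
  · obtain ⟨-, t, ht, hlt⟩ := hsub hx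
    have hαt : α ≤ t := by
      by_contra! h'
      have := hout t ht.1 h'
      linarith
    refine ⟨t, ⟨hαt, ht.2⟩, ?_⟩
    calc (F x - F s) / (x - s) ≤ l := by rw [div_le_iff₀ hxs]; linarith
      _ ≤ _ := by rw [le_div_iff₀ (sub_pos.2 ht.2)]; exact hlt.le

/-- The Fujii-Wilson condition for `dF`, with constant `C`. -/
def FujiiWilson (ν : Measure ℝ) (F : ℝ → ℝ) (C : ℝ≥0∞) : Prop :=
  ∀ a b, a < b → ∫⁻ x in Ioo a b, backwardSup F a x ≤ C * ν (Ioo a b)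

/-- The condition extends from intervals to upper level sets, because on each component the supremum
only sees that component. -/
lemma FujiiWilson.setLIntegral_upperLevel_le {C : ℝ≥0∞} (hC : FujiiWilson ν F C)
    (hF : Continuous F) (l a b : ℝ) :
    ∫⁻ x in upperLevel F l a b, backwardSup F a x ≤ C * ν (upperLevel F l a b) := by
  have := measure_le_of_components (μ := volume.withDensity (backwardSup F a)) (ν := C • ν)
    (isOpen_upperLevel hF l a b) (upperLevel_subset F l a b)
    fun α β hαβ hsub hα hβ => ?_
  · rwa [withDensity_apply _ (isOpen_upperLevel hF l a b).measurableSet] at this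
  obtain ⟨h1, h2⟩ := le_and_le_of_Ioo_subset hαβ hsub (upperLevel_subset F l a b)
  rw [withDensity_apply _ measurableSet_Ioo]
  exact (setLIntegral_mono' measurableSet_Ioo fun x hx =>
    backwardSup_le_of_component h2 hsub hα hx).trans (hC α β hαβ)

/-- The sets are nested, so the sum at `x` is a geometric sum stopping at the highest level that
contains `x`; it is at most twice that level. -/
lemma sum_indicator_upperLevel_le {l a b : ℝ} (hl : 0 ≤ l) (n : ℕ) (x : ℝ) :
    ∑ j ∈ Finset.range n, (upperLevel F (2 ^ j * l) a b).indicator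
      (fun _ => ENNReal.ofReal (2 ^ j * l)) x ≤
    (upperLevel F l a b).indicator (fun x => 2 * backwardSup F a x) x := by
  induction n with
  | zero => simp
  | succ n ih =>
    by_cases hx : x ∈ upperLevel F (2 ^ n * l) a b
    · have hx0 : x ∈ upperLevel F l a b :=
        upperLevel_anti F (le_mul_of_one_le_left hl (one_le_pow₀ (by norm_num))) a b hx
      rw [indicator_of_mem hx0]
      calc _ ≤ ∑ j ∈ Finset.range (n + 1), ENNReal.ofReal (2 ^ j * l) :=
            Finset.sum_le_sum fun j _ => indicator_le_self' (fun _ _ => zero_le) x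
        _ = ENNReal.ofReal (∑ j ∈ Finset.range (n + 1), 2 ^ j * l) :=
            (ENNReal.ofReal_sum_of_nonneg fun j _ => by positivity).symm
        _ ≤ ENNReal.ofReal (2 * (2 ^ n * l)) := by
            refine ENNReal.ofReal_le_ofReal ?_
            rw [← Finset.sum_mul, geom_sum_eq (by norm_num), pow_succ]
            nlinarith
        _ = 2 * ENNReal.ofReal (2 ^ n * l) := by
            rw [ENNReal.ofReal_mul (by norm_num)]; simp
        _ ≤ _ := by gcongr; exact ofReal_le_backwardSup hx.2
    · rw [Finset.sum_range_succ, indicator_of_notMem hx, add_zero]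
      exact ih

/-- Decay of the measure of the upper level sets. -/
lemma FujiiWilson.measure_upperLevel_le {C : ℝ≥0∞} (hC : FujiiWilson ν F C)
    (hF : IsDistribution ν F) {l a b : ℝ} (hl : 0 ≤ l)
    (hb : ∀ s ∈ Ico a b, F b - F s ≤ l * (b - s)) (n : ℕ) :
    (n + 1 : ℕ) * ν (upperLevel F (2 ^ n * l) a b) ≤ 2 * C * ν (Ioo a b) := by
  have hpow : ∀ j : ℕ, l ≤ 2 ^ j * l := fun j =>
    le_mul_of_one_le_left hl (one_le_pow₀ (by norm_num))
  have hmeas : ∀ j : ℕ, MeasurableSet (upperLevel F (2 ^ j * l) a b) := fun j =>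
    (isOpen_upperLevel hF.continuous _ a b).measurableSet
  have hmeas0 : MeasurableSet (upperLevel F l a b) :=
    (isOpen_upperLevel hF.continuous _ a b).measurableSet
  calc (n + 1 : ℕ) * ν (upperLevel F (2 ^ n * l) a b)
      = ∑ j ∈ Finset.range (n + 1), ν (upperLevel F (2 ^ n * l) a b) := by simp
    _ ≤ ∑ j ∈ Finset.range (n + 1), ν (upperLevel F (2 ^ j * l) a b) := by
        refine Finset.sum_le_sum fun j hj => measure_mono (upperLevel_anti F ?_ a b)
        have : j ≤ n := Nat.lt_succ_iff.1 (Finset.mem_range.1 hj)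
        gcongr
        norm_num
    _ ≤ ∑ j ∈ Finset.range (n + 1),
          ENNReal.ofReal (2 ^ j * l) * volume (upperLevel F (2 ^ j * l) a b) := by
        refine Finset.sum_le_sum fun j _ => hF.measure_upperLevel_le (by positivity) fun s hs =>
          (hb s hs).trans (mul_le_mul_of_nonneg_right (hpow j) (sub_pos.2 hs.2).le)
    _ = ∫⁻ x, ∑ j ∈ Finset.range (n + 1), (upperLevel F (2 ^ j * l) a b).indicator
          (fun _ => ENNReal.ofReal (2 ^ j * l)) x := by
        rw [lintegral_finsetSum _ fun j _ => measurable_const.indicator (hmeas j)]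
        exact Finset.sum_congr rfl fun j _ => (lintegral_indicator_const (hmeas j) _).symm
    _ ≤ ∫⁻ x, (upperLevel F l a b).indicator (fun x => 2 * backwardSup F a x) x :=
        lintegral_mono fun x => sum_indicator_upperLevel_le hl _ x
    _ = 2 * ∫⁻ x in upperLevel F l a b, backwardSup F a x := by
        rw [lintegral_indicator hmeas0, lintegral_const_mul' _ _ (by simp)]
    _ ≤ 2 * (C * ν (Ioo a b)) := by
        gcongr
        exact (hC.setLIntegral_upperLevel_le hF.continuous l a b).trans
          (by gcongr; exact upperLevel_subset F l a b)
    _ = _ := (mul_assoc _ _ _).symm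

/-- A point of `(b, c)` at which all the backward averages inside `(a, c)` are controlled. -/
lemma FujiiWilson.exists_backward_le {C : ℝ} (hC0 : 0 < C)
    (hC : FujiiWilson ν F (ENNReal.ofReal C)) (hF : IsDistribution ν F) {a b c : ℝ}
    (hab : a < b) (hbc : b < c) (hpos : 0 < F c - F a) :
    ∃ x ∈ Ioo b c, ∀ s ∈ Ico a x, F x - F s ≤ 2 * C * (F c - F a) / (c - b) * (x - s) := by
  -- Chebyshev: otherwise `backwardSup F a` is at least `l` on all of `(b, c)`, and its integral is
  -- at least twice what the condition on `(a, c)` allows.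
  by_contra! h
  set l := 2 * C * (F c - F a) / (c - b) with hl
  have hcb : 0 < c - b := sub_pos.2 hbc
  have h1 : ENNReal.ofReal (2 * (C * (F c - F a))) ≤ ENNReal.ofReal (C * (F c - F a)) :=
    calc ENNReal.ofReal (2 * (C * (F c - F a)))
        = ENNReal.ofReal l * volume (Ioo b c) := by
          rw [Real.volume_Ioo, ← ENNReal.ofReal_mul (by positivity), hl,
            div_mul_cancel₀ _ hcb.ne', mul_assoc]
      _ = ∫⁻ x in Ioo b c, ENNReal.ofReal l := by rw [setLIntegral_const]
      _ ≤ ∫⁻ x in Ioo b c, backwardSup F a x :=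
          setLIntegral_mono' measurableSet_Ioo fun x hx => ofReal_le_backwardSup (h x hx)
      _ ≤ ∫⁻ x in Ioo a c, backwardSup F a x :=
          lintegral_mono_set (Ioo_subset_Ioo_left hab.le)
      _ ≤ ENNReal.ofReal C * ν (Ioo a c) := hC a c (hab.trans hbc)
      _ = _ := by rw [hF.measure_Ioo _ _ (hab.trans hbc).le, ← ENNReal.ofReal_mul hC0.le]
  have h2 : 0 < C * (F c - F a) := by positivity
  rw [ENNReal.ofReal_le_ofReal_iff h2.le] at h1
  linarith

/-! ### Densities, absolute continuity and decay of lower level sets -/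

section Density

variable {w : ℝ → ℝ}

lemma le_of_notMem_upperLevel {l a b x : ℝ} (hd : HasDerivAt F (w x) x) (hx : x ∈ Ioo a b)
    (h : x ∉ upperLevel F l a b) : w x ≤ l := by
  have h1 := hd.tendsto_slope.mono_left (nhdsWithin_mono x (fun y (hy : y ∈ Iio x) => ne_of_lt hy))
  refine le_of_tendsto h1 ?_
  filter_upwards [Ioo_mem_nhdsLT hx.1] with s hs
  have h2 : F x - F s ≤ l * (x - s) := by
    by_contra! hlt
    exact h ⟨hx, s, ⟨hs.1.le, hs.2⟩, hlt⟩
  rw [slope_comm, slope_def_field, div_le_iff₀ (sub_pos.2 hs.2)]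
  exact h2

lemma le_of_notMem_lowerLevel {l b c x : ℝ} (hd : HasDerivAt F (w x) x) (hx : x ∈ Ioo b c)
    (h : x ∉ lowerLevel F l b c) : l ≤ w x := by
  have h1 := hd.tendsto_slope.mono_left (nhdsWithin_mono x (fun y (hy : y ∈ Ioi x) => ne_of_gt hy))
  refine ge_of_tendsto h1 ?_
  filter_upwards [Ioo_mem_nhdsGT hx.2] with s hs
  have h2 : l * (s - x) ≤ F s - F x := by
    by_contra! hlt
    exact h ⟨hx, s, ⟨hs.1, hs.2.le⟩, hlt⟩
  rw [slope_def_field, le_div_iff₀ (sub_pos.2 hs.1)]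
  exact h2

lemma measure_sdiff_upperLevel_le (hd : ∀ᵐ x, HasDerivAt F (w x) x) {l a b : ℝ} {E : Set ℝ}
    (hE : MeasurableSet E) (hEab : E ⊆ Ioo a b) (hdisj : Disjoint E (upperLevel F l a b)) :
    volume.withDensity (fun t => ENNReal.ofReal (w t)) E ≤ ENNReal.ofReal l * volume E := by
  rw [withDensity_apply _ hE, ← setLIntegral_const]
  refine setLIntegral_mono_ae' hE ?_
  filter_upwards [hd] with x hx hxE
  exact ENNReal.ofReal_le_ofReal
    (le_of_notMem_upperLevel hx (hEab hxE) (Set.disjoint_left.1 hdisj hxE))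

/-- Subsets of `(a, b)` of small Lebesgue measure carry a small part of the mass of `(a, c)`. -/
lemma FujiiWilson.measure_le {C : ℝ} (hC0 : 0 < C)
    (hC : FujiiWilson (volume.withDensity fun t => ENNReal.ofReal (w t)) F (ENNReal.ofReal C))
    (hF : IsDistribution (volume.withDensity fun t => ENNReal.ofReal (w t)) F)
    (hd : ∀ᵐ x, HasDerivAt F (w x) x) {n : ℕ} (hn : 8 * C ≤ n + 1) {a b c : ℝ}
    (hab : a < b) (hbc : b < c) (hpos : 0 < F c - F a) {E : Set ℝ} (hE : MeasurableSet E)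
    (hEab : E ⊆ Ioo a b) :
    volume.withDensity (fun t => ENNReal.ofReal (w t)) E ≤
      ENNReal.ofReal (2 ^ (n + 1) * C * (F c - F a) / (c - b)) * volume E +
        ENNReal.ofReal ((F c - F a) / 4) := by
  obtain ⟨x, hx, hxs⟩ := hC.exists_backward_le hC0 hF hab hbc hpos
  set ν := volume.withDensity fun t => ENNReal.ofReal (w t) with hν
  set l := 2 * C * (F c - F a) / (c - b) with hl
  have hcb : 0 < c - b := sub_pos.2 hbc
  have hl0 : 0 ≤ l := by positivity
  have hmeas : MeasurableSet (upperLevel F (2 ^ n * l) a x) :=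
    (isOpen_upperLevel hF.continuous _ a x).measurableSet
  have hlev : ν (upperLevel F (2 ^ n * l) a x) ≤ ENNReal.ofReal ((F c - F a) / 4) := by
    have h1 := hC.measure_upperLevel_le hF hl0 hxs n
    have h2 : ν (Ioo a x) ≤ ENNReal.ofReal (F c - F a) := by
      rw [← hF.measure_Ioo _ _ (hab.trans hbc).le]
      exact measure_mono (Ioo_subset_Ioo_right hx.2.le)
    have h3 : ENNReal.ofReal (8 * C) * ν (upperLevel F (2 ^ n * l) a x) ≤
        ENNReal.ofReal (8 * C) * ENNReal.ofReal ((F c - F a) / 4) :=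
      calc _ ≤ ((n + 1 : ℕ) : ℝ≥0∞) * ν (upperLevel F (2 ^ n * l) a x) := by
            gcongr
            rw [← ENNReal.ofReal_natCast]
            exact ENNReal.ofReal_le_ofReal (by exact_mod_cast hn)
        _ ≤ 2 * ENNReal.ofReal C * ENNReal.ofReal (F c - F a) := h1.trans (by gcongr)
        _ = _ := by
            rw [← ENNReal.ofReal_ofNat 2, ← ENNReal.ofReal_mul (by norm_num),
              ← ENNReal.ofReal_mul (by positivity), ← ENNReal.ofReal_mul (by positivity)]
            congr 1
            ring
    exact (ENNReal.mul_le_mul_iff_right (by simpa using hC0) ENNReal.ofReal_ne_top).1 h3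
  calc ν E ≤ ν (E \ upperLevel F (2 ^ n * l) a x) + ν (upperLevel F (2 ^ n * l) a x) := by
        rw [← measure_union disjoint_sdiff_left hmeas]
        exact measure_mono (by simp)
    _ ≤ ENNReal.ofReal (2 ^ n * l) * volume (E \ upperLevel F (2 ^ n * l) a x) +
          ENNReal.ofReal ((F c - F a) / 4) := by
        gcongr
        exact measure_sdiff_upperLevel_le hd (hE.diff hmeas)
          (sdiff_subset.trans (hEab.trans (Ioo_subset_Ioo_right hx.1.le))) disjoint_sdiff_left
    _ ≤ ENNReal.ofReal (2 ^ n * l) * volume E + ENNReal.ofReal ((F c - F a) / 4) := by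
        gcongr
        exact sdiff_subset
    _ = _ := by
        congr 3
        rw [hl]
        ring

/-- The level set `E` carries at most a quarter of the mass `l L` of the component, so substantial
mass lies outside `E`; by `FujiiWilson.measure_le` this requires substantial length. -/
lemma FujiiWilson.volume_lowerLevel_quarter_le_of_balanced {C : ℝ} (hC0 : 0 < C)
    (hC : FujiiWilson (volume.withDensity fun t => ENNReal.ofReal (w t)) F (ENNReal.ofReal C))
    (hF : IsDistribution (volume.withDensity fun t => ENNReal.ofReal (w t)) F)
    (hd : ∀ᵐ x, HasDerivAt F (w x) x) {n : ℕ} (hn : 8 * C ≤ n + 1) {l α β : ℝ}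
    (hl : 0 < l) (hαβ : α < β) (heq : F β - F α = l * (β - α))
    (hle : ∀ x ∈ Icc α β, F β - F x ≤ l * (β - x)) :
    volume (lowerLevel F (l / 4) α β) ≤
      ENNReal.ofReal ((1 - 1 / (2 ^ (n + 5) * C)) * (β - α)) := by
  set ν := volume.withDensity fun t => ENNReal.ofReal (w t) with hν
  set E := lowerLevel F (l / 4) α β with hEdef
  set L := β - α with hL
  have hL0 : 0 < L := sub_pos.2 hαβ
  have hEm : MeasurableSet E := (isOpen_lowerLevel hF.continuous _ α β).measurableSet
  have hEsub : E ⊆ Ioo α β := lowerLevel_subset F _ α β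
  -- `FujiiWilson.measure_le` needs room to the right of the set. The last quarter serves as room
  -- and costs at most a quarter of the mass, by `hle`.
  set b := β - L / 4 with hb
  have hαb : α < b := by rw [hb]; linarith
  have hbβ : b < β := by rw [hb]; linarith
  set G := Ioo α b \ E with hG
  have hGm : MeasurableSet G := measurableSet_Ioo.diff hEm
  have hGsub : G ⊆ Ioo α b := sdiff_subset
  have hEfin : volume E ≠ ∞ := measure_ne_top_of_subset hEsub (by simp)
  have hGfin : volume G ≠ ∞ := measure_ne_top_of_subset hGsub (by simp)
  have hsum : (volume E).toReal + (volume G).toReal ≤ L := by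
    rw [← ENNReal.toReal_add hEfin hGfin, ← measure_union disjoint_sdiff_right hGm]
    refine ENNReal.toReal_le_of_le_ofReal hL0.le ?_
    rw [hL, ← Real.volume_Ioo]
    exact measure_mono (union_subset hEsub (hGsub.trans (Ioo_subset_Ioo_right hbβ.le)))
  have hνE : ν E ≤ ENNReal.ofReal (l / 4 * L) := by
    rw [ENNReal.ofReal_mul (by positivity), hL, ← Real.volume_Ioo]
    exact (hF.measure_lowerLevel_le (by positivity) α β).trans (by gcongr)
  have hνG := hC.measure_le hC0 hF hd hn hαb hbβ (by rw [heq]; positivity) hGm hGsub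
  have hβb : β - b = L / 4 := by rw [hb]; ring
  rw [heq, hβb, ← ENNReal.ofReal_toReal hGfin, ← ENNReal.ofReal_mul (by positivity),
    ← ENNReal.ofReal_add (by positivity) (by positivity)] at hνG
  have h1 : 3 / 4 * (l * L) ≤ F b - F α := by
    have := hle b ⟨hαb.le, hbβ.le⟩
    rw [hβb] at this
    linarith
  have h2 : ENNReal.ofReal (3 / 4 * (l * L)) ≤
      ENNReal.ofReal (2 ^ (n + 1) * C * (l * L) / (L / 4) * (volume G).toReal + l * L / 4) +
        ENNReal.ofReal (l / 4 * L) :=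
    calc _ ≤ ν (Ioo α b) := by
          rw [hF.measure_Ioo _ _ hαb.le]
          exact ENNReal.ofReal_le_ofReal h1
      _ ≤ ν (G ∪ E) := measure_mono (by rw [hG]; simp)
      _ ≤ ν G + ν E := measure_union_le _ _
      _ ≤ _ := add_le_add hνG hνE
  rw [← ENNReal.ofReal_add (by positivity) (by positivity),
    ENNReal.ofReal_le_ofReal_iff (by positivity)] at h2
  -- Of the mass `3/4 l L` left of `b`, `E` takes one quarter and the error term another. The
  -- remaining `l L / 4` is paid by the length of `G`; dividing by `L/4` and by `l/4` turns
  -- `2^(n+1)` into `2^(n+5)`.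
  have h3 : L ≤ 2 ^ (n + 5) * C * (volume G).toReal := by
    have e : 2 ^ (n + 1) * C * (l * L) / (L / 4) * (volume G).toReal =
        l / 4 * (2 ^ (n + 5) * C * (volume G).toReal) := by
      field_simp
      ring
    rw [e] at h2
    have : l / 4 * L ≤ l / 4 * (2 ^ (n + 5) * C * (volume G).toReal) := by linarith
    exact le_of_mul_le_mul_left this (by positivity)
  have h4 : 1 / (2 ^ (n + 5) * C) * L ≤ (volume G).toReal := by
    rw [one_div_mul_eq_div, div_le_iff₀ (by positivity)]
    linarith
  rw [← ENNReal.ofReal_toReal hEfin]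
  exact ENNReal.ofReal_le_ofReal (by linarith)

/-- The hypothesis at `b` makes a component starting at `b` balanced too; for the others this
follows from `α` lying outside the set. -/
lemma FujiiWilson.volume_lowerLevel_quarter_le {C : ℝ} (hC0 : 0 < C)
    (hC : FujiiWilson (volume.withDensity fun t => ENNReal.ofReal (w t)) F (ENNReal.ofReal C))
    (hF : IsDistribution (volume.withDensity fun t => ENNReal.ofReal (w t)) F)
    (hd : ∀ᵐ x, HasDerivAt F (w x) x) {n : ℕ} (hn : 8 * C ≤ n + 1) {l b c : ℝ}
    (hl : 0 < l) (hb : ∀ y ∈ Ioc b c, l * (y - b) ≤ F y - F b) :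
    volume (lowerLevel F (l / 4) b c) ≤
      ENNReal.ofReal (1 - 1 / (2 ^ (n + 5) * C)) * volume (lowerLevel F l b c) := by
  have hsub4 : lowerLevel F (l / 4) b c ⊆ lowerLevel F l b c :=
    lowerLevel_mono F (by linarith) b c
  have hm4 : MeasurableSet (lowerLevel F (l / 4) b c) :=
    (isOpen_lowerLevel hF.continuous _ b c).measurableSet
  have := measure_le_of_components (μ := volume.restrict (lowerLevel F (l / 4) b c))
    (ν := ENNReal.ofReal (1 - 1 / (2 ^ (n + 5) * C)) • (volume : Measure ℝ))
    (isOpen_lowerLevel hF.continuous l b c) (lowerLevel_subset F l b c)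
    fun α β hαβ hsub hα hβ => ?_
  · rwa [Measure.restrict_apply' hm4, inter_eq_right.2 hsub4] at this
  obtain ⟨h1, h2⟩ := le_and_le_of_Ioo_subset hαβ hsub (lowerLevel_subset F l b c)
  have hle : ∀ x ∈ Icc α β, F β - F x ≤ l * (β - x) := fun x hx =>
    le_of_mem_component_lowerLevel hF.continuous hαβ hsub hβ hx
  have hge : l * (β - α) ≤ F β - F α := by
    rcases h1.eq_or_lt with rfl | h1
    · exact hb β ⟨hαβ, h2⟩
    · by_contra! hlt
      exact hα ⟨⟨h1, hαβ.trans_le h2⟩, β, ⟨hαβ, h2⟩, hlt⟩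
  rw [Measure.restrict_apply' hm4, inter_comm,
    lowerLevel_inter_Ioo h1 h2 hαβ (fun h => hβ (hsub4 h)), Measure.smul_apply, smul_eq_mul,
    Real.volume_Ioo, ← ENNReal.ofReal_mul' (sub_pos.2 hαβ).le]
  exact hC.volume_lowerLevel_quarter_le_of_balanced hC0 hF hd hn hl hαβ
    (le_antisymm (hle α ⟨le_rfl, hαβ.le⟩) hge) hle

/-- Geometric decay of the Lebesgue measure of the lower level sets. -/
lemma FujiiWilson.volume_lowerLevel_le {C : ℝ} (hC0 : 0 < C)
    (hC : FujiiWilson (volume.withDensity fun t => ENNReal.ofReal (w t)) F (ENNReal.ofReal C))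
    (hF : IsDistribution (volume.withDensity fun t => ENNReal.ofReal (w t)) F)
    (hd : ∀ᵐ x, HasDerivAt F (w x) x) {n : ℕ} (hn : 8 * C ≤ n + 1) {l b c : ℝ}
    (hl : 0 < l) (hb : ∀ y ∈ Ioc b c, l * (y - b) ≤ F y - F b) (k : ℕ) :
    volume (lowerLevel F (l / 4 ^ k) b c) ≤
      ENNReal.ofReal (1 - 1 / (2 ^ (n + 5) * C)) ^ k * ENNReal.ofReal (c - b) := by
  induction k with
  | zero =>
    rw [pow_zero (ENNReal.ofReal _), one_mul, ← Real.volume_Ioo]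
    exact measure_mono (lowerLevel_subset F _ b c)
  | succ k ih =>
    have h1 : l / 4 ^ (k + 1) = l / 4 ^ k / 4 := by rw [pow_succ, div_div]
    rw [h1, pow_succ', mul_assoc]
    refine (hC.volume_lowerLevel_quarter_le hC0 hF hd hn (by positivity) fun y hy =>
      le_trans ?_ (hb y hy)).trans (by gcongr)
    refine mul_le_mul_of_nonneg_right ?_ (sub_pos.2 hy.1).le
    exact div_le_self hl.le (one_le_pow₀ (by norm_num))

/-- Otherwise `(a, b)` lies in a lower level set of `(a, c)`, whose mass is at most half of `F b - F
a`. -/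
lemma IsDistribution.exists_forward_ge {ν : Measure ℝ} (hF : IsDistribution ν F) {a b c : ℝ}
    (hab : a < b) (hbc : b < c) (hpos : 0 < F b - F a) :
    ∃ x ∈ Ioo a b, ∀ y ∈ Ioc x c, (F b - F a) / (c - a) / 2 * (y - x) ≤ F y - F x := by
  by_contra! h
  have hca : 0 < c - a := by linarith
  have h1 : ENNReal.ofReal (F b - F a) ≤ ENNReal.ofReal ((F b - F a) / 2) := by
    rw [← hF.measure_Ioo _ _ hab.le]
    calc ν (Ioo a b) ≤ ν (lowerLevel F ((F b - F a) / (c - a) / 2) a c) :=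
          measure_mono fun x hx => ⟨⟨hx.1, hx.2.trans hbc⟩, h x hx⟩
      _ ≤ ENNReal.ofReal ((F b - F a) / (c - a) / 2) *
            volume (lowerLevel F ((F b - F a) / (c - a) / 2) a c) :=
          hF.measure_lowerLevel_le (by positivity) a c
      _ ≤ ENNReal.ofReal ((F b - F a) / (c - a) / 2) * volume (Ioo a c) := by
          gcongr
          exact lowerLevel_subset F _ a c
      _ = _ := by
          rw [Real.volume_Ioo, ← ENNReal.ofReal_mul (by positivity)]
          congr 1
          field_simp
  rw [ENNReal.ofReal_le_ofReal_iff (by positivity)] at h1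
  linarith

/-- Layer decomposition of a negative power. -/
lemma rpow_neg_le_tsum_layers {q l u : ℝ} (hq : 0 < q) (hl : 0 < l) {P : ℕ → Prop}
    (hP : ∀ k, ¬ P k → l / 4 ^ k ≤ u) :
    ENNReal.ofReal u ^ (-q) ≤ ENNReal.ofReal l ^ (-q) +
      ∑' k : ℕ, {k | P k}.indicator (fun k => ENNReal.ofReal (l / 4 ^ (k + 1)) ^ (-q)) k := by
  have hanti : ∀ {x y : ℝ}, x ≤ y → ENNReal.ofReal y ^ (-q) ≤ ENNReal.ofReal x ^ (-q) := by
    intro x y hxy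
    rw [ENNReal.rpow_neg, ENNReal.rpow_neg, ENNReal.inv_le_inv]
    exact ENNReal.rpow_le_rpow (ENNReal.ofReal_le_ofReal hxy) hq.le
  -- If all layers contain the point, as happens when `u = 0`, the series diverges. Otherwise the
  -- term just before the first missing layer suffices, hence the exponent `k + 1`.
  by_cases h : ∀ k, P k
  · have hinf : ∑' k : ℕ, {k | P k}.indicator
        (fun k => ENNReal.ofReal (l / 4 ^ (k + 1)) ^ (-q)) k = ∞ := by
      refine top_le_iff.1 ?_
      rw [← ENNReal.tsum_const_eq_top_of_ne_zero (α := ℕ) (c := ENNReal.ofReal l ^ (-q))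
        (by simp [ENNReal.rpow_eq_zero_iff, hq.le, hq])]
      refine ENNReal.tsum_le_tsum fun k => ?_
      rw [indicator_of_mem (show k ∈ {k | P k} from h k)]
      exact hanti (div_le_self hl.le (one_le_pow₀ (by norm_num)))
    rw [hinf, add_top]
    exact le_top
  · classical
    push Not at h
    have hmin := Nat.find_spec h
    rcases Nat.eq_zero_or_pos (Nat.find h) with h0 | h0
    · rw [h0] at hmin
      exact (hanti (by simpa using hP 0 hmin)).trans le_self_add
    · obtain ⟨m, hm⟩ := Nat.exists_eq_succ_of_ne_zero h0.ne'
      have hPm : P m := not_not.1 (Nat.find_min h (m := m) (by omega))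
      rw [hm] at hmin
      refine le_trans ?_ (le_trans (ENNReal.le_tsum m) le_add_self)
      rw [indicator_of_mem (show m ∈ {k | P k} from hPm)]
      exact hanti (hP _ hmin)

lemma FujiiWilson.lintegral_rpow_neg_le {C : ℝ} (hC0 : 0 < C)
    (hC : FujiiWilson (volume.withDensity fun t => ENNReal.ofReal (w t)) F (ENNReal.ofReal C))
    (hF : IsDistribution (volume.withDensity fun t => ENNReal.ofReal (w t)) F)
    (hd : ∀ᵐ x, HasDerivAt F (w x) x) {n : ℕ} (hn : 8 * C ≤ n + 1) {a b c q : ℝ} (hq : 0 < q)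
    (hab : a < b) (hbc : b < c) (hpos : 0 < F b - F a) :
    ∫⁻ t in Ioo b c, ENNReal.ofReal (w t) ^ (-q) ≤
      ENNReal.ofReal ((F b - F a) / (c - a) / 2) ^ (-q) * ENNReal.ofReal (c - a) +
      ∑' k : ℕ, ENNReal.ofReal ((F b - F a) / (c - a) / 2 / 4 ^ (k + 1)) ^ (-q) *
        (ENNReal.ofReal (1 - 1 / (2 ^ (n + 5) * C)) ^ k * ENNReal.ofReal (c - a)) := by
  obtain ⟨x, hx, hxy⟩ := hF.exists_forward_ge hab hbc hpos
  have hca : 0 < c - a := by linarith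
  set l := (F b - F a) / (c - a) / 2 with hl
  have hl0 : 0 < l := by positivity
  have hmeas : ∀ k : ℕ, MeasurableSet (lowerLevel F (l / 4 ^ k) x c) := fun k =>
    (isOpen_lowerLevel hF.continuous _ x c).measurableSet
  calc ∫⁻ t in Ioo b c, ENNReal.ofReal (w t) ^ (-q)
      ≤ ∫⁻ t in Ioo b c, (ENNReal.ofReal l ^ (-q) +
          ∑' k : ℕ, (lowerLevel F (l / 4 ^ k) x c).indicator
            (fun _ => ENNReal.ofReal (l / 4 ^ (k + 1)) ^ (-q)) t) := by
        refine setLIntegral_mono_ae' measurableSet_Ioo ?_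
        filter_upwards [hd] with t ht htbc
        exact rpow_neg_le_tsum_layers (P := fun k => t ∈ lowerLevel F (l / 4 ^ k) x c) hq hl0
          fun k hk => le_of_notMem_lowerLevel ht ⟨hx.2.trans htbc.1, htbc.2⟩ hk
    _ = ENNReal.ofReal l ^ (-q) * volume (Ioo b c) +
          ∑' k : ℕ, ∫⁻ t in Ioo b c, (lowerLevel F (l / 4 ^ k) x c).indicator
            (fun _ => ENNReal.ofReal (l / 4 ^ (k + 1)) ^ (-q)) t := by
        rw [lintegral_add_left measurable_const, setLIntegral_const, lintegral_tsum]
        exact fun k => (measurable_const.indicator (hmeas k)).aemeasurable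
    _ ≤ _ := by
        gcongr with k
        · rw [Real.volume_Ioo]
          exact ENNReal.ofReal_le_ofReal (by linarith)
        · refine (setLIntegral_le_lintegral _ _).trans ?_
          rw [lintegral_indicator_const (hmeas k)]
          gcongr
          refine (hC.volume_lowerLevel_le hC0 hF hd hn hl0 hxy k).trans ?_
          gcongr
          linarith [hx.1]

end Density

/-! ### Summing the layers -/

/-- Bernoulli's inequality with exponent `8/δ`. -/
lemma four_rpow_le {δ : ℝ} (h0 : 0 < δ) (h1 : δ ≤ 1) : (4 : ℝ) ^ (δ / 8) ≤ 1 + δ / 2 := by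
  have h : (1 : ℝ) + 8 / δ * (δ / 2) ≤ (1 + δ / 2) ^ (8 / δ) :=
    one_add_mul_self_le_rpow_one_add (by linarith) (by rw [le_div_iff₀ h0]; linarith)
  have e : (8 : ℝ) / δ * (δ / 2) = 4 := by field_simp; norm_num
  rw [e] at h
  calc (4 : ℝ) ^ (δ / 8) ≤ ((1 + δ / 2) ^ (8 / δ)) ^ (δ / 8) :=
        Real.rpow_le_rpow (by norm_num) (by linarith) (by positivity)
    _ = 1 + δ / 2 := by
        rw [← Real.rpow_mul (by positivity)]
        have : 8 / δ * (δ / 8) = 1 := by field_simp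
        rw [this, Real.rpow_one]

lemma tsum_layers_le {δ l M : ℝ} (h0 : 0 < δ) (h1 : δ ≤ 1) (hl : 0 < l) (hM : 0 < M) :
    ENNReal.ofReal l ^ (-(δ / 8)) * ENNReal.ofReal M +
      ∑' k : ℕ, ENNReal.ofReal (l / 4 ^ (k + 1)) ^ (-(δ / 8)) *
        (ENNReal.ofReal (1 - δ) ^ k * ENNReal.ofReal M) ≤
      ENNReal.ofReal (l ^ (-(δ / 8)) * M * (5 / δ)) := by
  set q := δ / 8 with hq
  set K := (4 : ℝ) ^ q with hK
  have hK0 : 0 < K := by positivity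
  have hKle : K ≤ 1 + δ / 2 := four_rpow_le h0 h1
  have hlq : 0 < l ^ (-q) := Real.rpow_pos_of_pos hl _
  -- The exponent `δ/8` is small enough that the growth `K = 4^q` per layer loses to the decay `1 -
  -- δ`.
  have hKδ : K * (1 - δ) ≤ 1 - δ / 2 :=
    (mul_le_mul_of_nonneg_right hKle (by linarith)).trans (by nlinarith)
  have hterm : ∀ k : ℕ, ENNReal.ofReal (l / 4 ^ (k + 1)) ^ (-q) *
      (ENNReal.ofReal (1 - δ) ^ k * ENNReal.ofReal M) =
      ENNReal.ofReal (l ^ (-q) * M * K) * ENNReal.ofReal (K * (1 - δ)) ^ k := by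
    intro k
    have e : (l / 4 ^ (k + 1)) ^ (-q) = l ^ (-q) * K ^ (k + 1) := by
      rw [Real.div_rpow hl.le (by positivity), Real.rpow_neg (by positivity : (0 : ℝ) ≤ 4 ^ (k + 1)),
        div_inv_eq_mul, hK, ← Real.rpow_natCast, ← Real.rpow_natCast, ← Real.rpow_mul (by norm_num),
        ← Real.rpow_mul (by norm_num), mul_comm q]
    rw [ENNReal.ofReal_rpow_of_pos (by positivity), e, ← ENNReal.ofReal_pow (by linarith),
      ← ENNReal.ofReal_pow (mul_nonneg hK0.le (by linarith)), ← ENNReal.ofReal_mul (by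
        have := pow_nonneg (sub_nonneg.2 h1) k
        positivity), ← ENNReal.ofReal_mul (by positivity), ← ENNReal.ofReal_mul (by positivity)]
    congr 1
    rw [mul_pow, pow_succ]
    ring
  have hgeom : ∑' k : ℕ, ENNReal.ofReal (K * (1 - δ)) ^ k ≤ ENNReal.ofReal (2 / δ) := by
    rw [ENNReal.tsum_geometric, ← inv_div, ENNReal.ofReal_inv_of_pos (by positivity),
      ENNReal.inv_le_inv, ← ENNReal.ofReal_one, ← ENNReal.ofReal_sub _
        (mul_nonneg hK0.le (by linarith))]
    exact ENNReal.ofReal_le_ofReal (by linarith)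
  calc _ = ENNReal.ofReal (l ^ (-q) * M) + ENNReal.ofReal (l ^ (-q) * M * K) *
          ∑' k : ℕ, ENNReal.ofReal (K * (1 - δ)) ^ k := by
        rw [← ENNReal.tsum_mul_left, ENNReal.ofReal_rpow_of_pos hl,
          ← ENNReal.ofReal_mul (by positivity)]
        simp_rw [hterm]
    _ ≤ ENNReal.ofReal (l ^ (-q) * M) +
          ENNReal.ofReal (l ^ (-q) * M * K) * ENNReal.ofReal (2 / δ) := by gcongr
    _ = ENNReal.ofReal (l ^ (-q) * M * (1 + K * (2 / δ))) := by
        rw [← ENNReal.ofReal_mul (by positivity), ← ENNReal.ofReal_add (by positivity)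
          (by positivity)]
        congr 1
        ring
    _ ≤ _ := by
        refine ENNReal.ofReal_le_ofReal (mul_le_mul_of_nonneg_left ?_ (by positivity))
        calc 1 + K * (2 / δ) ≤ 1 / δ + 2 * (2 / δ) := by
              refine add_le_add ((le_div_iff₀ h0).2 (by linarith)) ?_
              exact mul_le_mul_of_nonneg_right (by linarith) (by positivity)
          _ = 5 / δ := by ring

/-- Monotonicity in the exponent of normalised power means over a set of measure at most `M`. -/
lemma rpow_mean_le_rpow_mean {f : ℝ → ℝ≥0∞} (hf : AEMeasurable f) {S : Set ℝ} {M : ℝ}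
    (hS : volume S ≤ ENNReal.ofReal M) {q r : ℝ} (hq : 0 < q) (hqr : q ≤ r) :
    ((∫⁻ t in S, f t ^ q) / ENNReal.ofReal M) ^ (1 / q) ≤
      ((∫⁻ t in S, f t ^ r) / ENNReal.ofReal M) ^ (1 / r) := by
  set μ : Measure ℝ := (ENNReal.ofReal M)⁻¹ • volume.restrict S with hμ
  have hf' : AEMeasurable f μ := (hf.restrict).smul_measure _
  have h := eLpNorm'_le_eLpNorm'_mul_rpow_measure_univ hq hqr hf'.aestronglyMeasurable
  have huniv : μ univ ≤ 1 := by
    rw [hμ, Measure.smul_apply, Measure.restrict_apply_univ, smul_eq_mul, mul_comm,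
      ← div_eq_mul_inv]
    exact ENNReal.div_le_of_le_mul (by simpa using hS)
  have h' : eLpNorm' f q μ ≤ eLpNorm' f r μ := h.trans (mul_le_of_le_one_right' (by
    refine ENNReal.rpow_le_one huniv (sub_nonneg.2 ?_)
    exact one_div_le_one_div_of_le hq hqr))
  simpa only [eLpNorm', hμ, lintegral_smul_measure, enorm_eq_self, smul_eq_mul, div_eq_mul_inv,
    one_mul, mul_comm (ENNReal.ofReal M)⁻¹] using h'

/-! ### From weights to distribution functions -/

lemma IsWeight.intervalIntegrable {w : ℝ → ℝ} (hw : IsWeight w) (a b : ℝ) :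
    IntervalIntegrable w volume a b :=
  intervalIntegrable_iff.2
    ((hw.locallyIntegrable.integrableOn_isCompact isCompact_uIcc).mono_set uIoc_subset_uIcc)

lemma mass_eq_withDensity (w : ℝ → ℝ) (a b : ℝ) :
    mass w a b = volume.withDensity (fun t => ENNReal.ofReal (w t)) (Ioo a b) :=
  (withDensity_apply _ measurableSet_Ioo).symm

lemma IsWeight.isDistribution {w : ℝ → ℝ} (hw : IsWeight w) :
    IsDistribution (volume.withDensity fun t => ENNReal.ofReal (w t))
      (fun x => ∫ t in (0 : ℝ)..x, w t) where
  continuous := intervalIntegral.continuous_primitive hw.intervalIntegrable 0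
  monotone := fun s t hst => by
    rw [← sub_nonneg, intervalIntegral.integral_interval_sub_left (hw.intervalIntegrable _ _)
      (hw.intervalIntegrable _ _)]
    exact intervalIntegral.integral_nonneg hst fun u _ => hw.nonneg u
  measure_Ioo := fun s t hst => by
    rw [withDensity_apply _ measurableSet_Ioo, intervalIntegral.integral_interval_sub_left
      (hw.intervalIntegrable _ _) (hw.intervalIntegrable _ _), intervalIntegral.integral_of_le hst,
      ← restrict_Ioo_eq_restrict_Ioc]
    refine (ofReal_integral_eq_lintegral_ofReal ?_ (ae_of_all _ hw.nonneg)).symm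
    exact ((intervalIntegrable_iff_integrableOn_Ioc_of_le hst).1
      (hw.intervalIntegrable s t)).mono_set Ioo_subset_Ioc_self

lemma IsWeight.backwardSup_le_maximalMinus {w : ℝ → ℝ} (hw : IsWeight w) {a b x : ℝ}
    (hx : x ∈ Ioo a b) : backwardSup (fun x => ∫ t in (0 : ℝ)..x, w t) a x ≤
      maximalMinus ((Ioo a b).indicator w) x := by
  refine iSup₂_le fun s hs => ?_
  have hsx : 0 < x - s := sub_pos.2 hs.2
  refine le_trans ?_ (le_iSup₂ (f := fun (h : ℝ) (_ : 0 < h) => (∫⁻ t in Ioo (x - h) x,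
    ENNReal.ofReal |(Ioo a b).indicator w t|) / ENNReal.ofReal h) (x - s) hsx)
  rw [ENNReal.ofReal_div_of_pos hsx, ← hw.isDistribution.measure_Ioo _ _ hs.2.le,
    ← mass_eq_withDensity, sub_sub_cancel, mass]
  gcongr ?_ / _
  refine setLIntegral_mono' measurableSet_Ioo fun t ht => ENNReal.ofReal_le_ofReal ?_
  rw [indicator_of_mem (show t ∈ Ioo a b from ⟨hs.1.trans_lt ht.1, ht.2.trans hx.2⟩)]
  exact le_abs_self _

lemma fujiiWilson_of_mem {w : ℝ → ℝ} (hw : w ∈ AInftyPlus) :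
    FujiiWilson (volume.withDensity fun t => ENNReal.ofReal (w t))
      (fun x => ∫ t in (0 : ℝ)..x, w t) (aInftyPlusConst w) := by
  intro a b hab
  have h1 : (∫⁻ x in Ioo a b, maximalMinus ((Ioo a b).indicator w) x) / mass w a b ≤
      aInftyPlusConst w :=
    le_trans (le_iSup (fun _ : a < b => (∫⁻ x in Ioo a b,
      maximalMinus ((Ioo a b).indicator w) x) / mass w a b) hab)
      (le_iSup₂ (f := fun a b : ℝ => ⨆ (_ : a < b), (∫⁻ x in Ioo a b,
        maximalMinus ((Ioo a b).indicator w) x) / mass w a b) a b)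
  have hm : mass w a b ≠ ∞ := by
    rw [mass_eq_withDensity, hw.1.isDistribution.measure_Ioo _ _ hab.le]
    exact ENNReal.ofReal_ne_top
  rw [ENNReal.div_le_iff_le_mul (.inr hw.2.ne) (.inl hm), mass_eq_withDensity] at h1
  exact (setLIntegral_mono' measurableSet_Ioo fun x hx =>
    hw.1.backwardSup_le_maximalMinus hx).trans h1

lemma IsWeight.ae_hasDerivAt {w : ℝ → ℝ} (hw : IsWeight w) :
    ∀ᵐ x, HasDerivAt (fun x => ∫ t in (0 : ℝ)..x, w t) (w x) x :=
  (LocallyIntegrable.ae_hasDerivAt_integral hw.locallyIntegrable).mono fun _ h => h 0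

lemma ofReal_le_backwardSup_of_hasDerivAt {w F : ℝ → ℝ} {a x : ℝ} (hd : HasDerivAt F (w x) x)
    (hx : a < x) : ENNReal.ofReal (w x) ≤ backwardSup F a x := by
  by_contra! h
  obtain ⟨l, hl, hlt⟩ := ENNReal.lt_iff_exists_nnreal_btwn.1 h
  rw [← ENNReal.ofReal_coe_nnreal] at hl hlt
  have hlw : (l : ℝ) < w x := (ENNReal.ofReal_lt_ofReal_iff_of_nonneg l.2).1 hlt
  have hmem : x ∈ upperLevel F l a (x + 1) := by
    by_contra hmem
    exact absurd (le_of_notMem_upperLevel hd ⟨hx, by linarith⟩ hmem) (not_le.2 hlw)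
  exact absurd (ofReal_le_backwardSup hmem.2) (not_le.2 hl)

/-- The Fujii-Wilson constant of a weight with some mass is at least `1`. -/
lemma one_le_aInftyPlusConst {w : ℝ → ℝ} (hw : w ∈ AInftyPlus) {a b : ℝ} (hab : a < b)
    (hm : mass w a b ≠ 0) : 1 ≤ aInftyPlusConst w := by
  have htop : mass w a b ≠ ∞ := by
    rw [mass_eq_withDensity, hw.1.isDistribution.measure_Ioo _ _ hab.le]
    exact ENNReal.ofReal_ne_top
  have h : mass w a b ≤ aInftyPlusConst w * mass w a b := by
    refine le_trans ?_ ((fujiiWilson_of_mem hw a b hab).trans_eq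
      (by rw [mass_eq_withDensity]))
    refine setLIntegral_mono_ae' measurableSet_Ioo ?_
    filter_upwards [hw.1.ae_hasDerivAt] with x hx hxab
    exact ofReal_le_backwardSup_of_hasDerivAt hx hxab.1
  rw [← ENNReal.div_le_iff_le_mul (.inl hm) (.inl htop), ENNReal.div_self hm htop] at h
  exact h

/-- The `A_p` product over a single triple `a < b < c`, in terms of the decay rate `δ`. -/
lemma mass_mul_rpow_le {w : ℝ → ℝ} (hw : w ∈ AInftyPlus) {C : ℝ} (hC1 : 1 ≤ C)
    (hC : aInftyPlusConst w = ENNReal.ofReal C) {n : ℕ} (hn : 8 * C ≤ n + 1) {δ : ℝ}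
    (hδ : δ = 1 / (2 ^ (n + 5) * C)) {p : ℝ} (hp : 1 + 8 / δ ≤ p) {a b c : ℝ} (hab : a < b)
    (hbc : b < c) (hm : mass w a b ≠ 0) :
    mass w a b / ENNReal.ofReal (c - a) *
      ((∫⁻ t in Ioo b c, dualWeight p w t) / ENNReal.ofReal (c - a)) ^ (p - 1) ≤
      ENNReal.ofReal ((10 / δ) ^ (8 / δ)) := by
  have hca : 0 < c - a := by linarith
  have hδ0 : 0 < δ := by rw [hδ]; positivity
  have hδ1 : δ ≤ 1 := by
    rw [hδ, div_le_one (by positivity)]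
    exact one_le_mul_of_one_le_of_one_le (one_le_pow₀ (by norm_num)) hC1
  set F := fun x => ∫ t in (0 : ℝ)..x, w t with hFdef
  have hF := hw.1.isDistribution
  have hFW := fujiiWilson_of_mem hw
  rw [hC] at hFW
  have hmass : mass w a b = ENNReal.ofReal (F b - F a) := by
    rw [mass_eq_withDensity, hF.measure_Ioo _ _ hab.le]
  have hpos : 0 < F b - F a := by
    rw [hmass] at hm
    simpa using hm
  set v := (F b - F a) / (c - a) with hv
  have hv0 : 0 < v := by positivity
  have h8 : 0 < 8 / δ := by positivity
  have hp1 : 0 < p - 1 := by linarith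
  have hw_meas : AEMeasurable (fun t => ENNReal.ofReal (w t)) :=
    hw.1.locallyIntegrable.aestronglyMeasurable.aemeasurable.ennreal_ofReal
  have hmain : ∫⁻ t in Ioo b c, ENNReal.ofReal (w t) ^ (-(δ / 8)) ≤
      ENNReal.ofReal ((v / 2) ^ (-(δ / 8)) * (c - a) * (5 / δ)) := by
    refine le_trans ?_ (tsum_layers_le hδ0 hδ1 (half_pos hv0) hca)
    have := hFW.lintegral_rpow_neg_le (by linarith) hF hw.1.ae_hasDerivAt hn
      (q := δ / 8) (by positivity) hab hbc hpos
    rwa [← hδ] at this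
  -- Jensen for `1/w` with values in `[0, ∞]`: `p ≥ 1 + 8/δ` means `1/(p-1) ≤ δ/8`.
  have hmean := rpow_mean_le_rpow_mean hw_meas.inv (S := Ioo b c) (M := c - a)
    (by rw [Real.volume_Ioo]; exact ENNReal.ofReal_le_ofReal (by linarith))
    (q := 1 / (p - 1)) (r := δ / 8) (by positivity)
    (by rw [div_le_iff₀ hp1]
        calc (1 : ℝ) = δ / 8 * (8 / δ) := by field_simp
          _ ≤ δ / 8 * (p - 1) := mul_le_mul_of_nonneg_left (by linarith) (by positivity))
  simp only [Pi.inv_apply, ENNReal.inv_rpow, ← ENNReal.rpow_neg, one_div_div,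
    div_one] at hmean
  have hv2 : (v / 2) ^ (-(δ / 8)) ≤ v ^ (-(δ / 8)) * 2 := by
    rw [Real.div_rpow hv0.le (by norm_num), Real.rpow_neg (by norm_num : (0 : ℝ) ≤ 2),
      div_inv_eq_mul]
    refine mul_le_mul_of_nonneg_left ?_ (by positivity)
    calc (2 : ℝ) ^ (δ / 8) ≤ 2 ^ (1 : ℝ) :=
          Real.rpow_le_rpow_of_exponent_le (by norm_num) (by linarith)
      _ = 2 := Real.rpow_one 2
  calc mass w a b / ENNReal.ofReal (c - a) *
        ((∫⁻ t in Ioo b c, dualWeight p w t) / ENNReal.ofReal (c - a)) ^ (p - 1)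
      ≤ ENNReal.ofReal v * ((∫⁻ t in Ioo b c, ENNReal.ofReal (w t) ^ (-(δ / 8))) /
          ENNReal.ofReal (c - a)) ^ (8 / δ) := by
        rw [hmass, ← ENNReal.ofReal_div_of_pos hca]
        gcongr
        exact hmean
    _ ≤ ENNReal.ofReal v * (ENNReal.ofReal (v ^ (-(δ / 8)) * (10 / δ))) ^ (8 / δ) := by
        gcongr
        refine ENNReal.div_le_of_le_mul (hmain.trans ?_)
        rw [← ENNReal.ofReal_mul (by positivity)]
        refine ENNReal.ofReal_le_ofReal ?_
        calc (v / 2) ^ (-(δ / 8)) * (c - a) * (5 / δ)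
            ≤ v ^ (-(δ / 8)) * 2 * (c - a) * (5 / δ) := by gcongr
          _ = _ := by ring
    _ = ENNReal.ofReal ((10 / δ) ^ (8 / δ)) := by
        rw [ENNReal.ofReal_rpow_of_pos (by positivity), ← ENNReal.ofReal_mul hv0.le,
          Real.mul_rpow (by positivity) (by positivity), ← Real.rpow_mul hv0.le]
        have e : -(δ / 8) * (8 / δ) = -1 := by field_simp
        rw [e, Real.rpow_neg_one, mul_inv_cancel_left₀ hv0.ne']

/-! ### Numerical constants and conclusion -/

lemma rpow_self_le_exp {D : ℝ} (hD : 0 < D) : (10 * D) ^ (8 * D) ≤ Real.exp (80 * D ^ 2) := by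
  rw [Real.rpow_def_of_pos (by positivity)]
  refine Real.exp_le_exp.2 ?_
  have := Real.log_le_self (by positivity : 0 ≤ 10 * D)
  calc Real.log (10 * D) * (8 * D) ≤ 10 * D * (8 * D) := by gcongr
    _ = 80 * D ^ 2 := by ring

lemma two_pow_mul_le_exp {C : ℝ} (hC : 1 ≤ C) {n : ℕ} (hn : (n : ℝ) ≤ 8 * C + 1) :
    2 ^ (n + 5) * C ≤ Real.exp (15 * C) := by
  have h2 : (2 : ℝ) ≤ Real.exp 1 := by linarith [Real.add_one_le_exp 1]
  calc 2 ^ (n + 5) * C ≤ Real.exp 1 ^ (n + 5) * Real.exp C := by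
        gcongr
        linarith [Real.add_one_le_exp C]
    _ = Real.exp ((n + 5 : ℕ) + C) := by
        rw [← Real.exp_nat_mul, mul_one, ← Real.exp_add]
    _ ≤ _ := by
        refine Real.exp_le_exp.2 ?_
        push_cast
        linarith

lemma eighty_le_exp {C : ℝ} (hC : 1 ≤ C) : 80 ≤ Real.exp (5 * C) := by
  calc (80 : ℝ) ≤ 2.7 ^ 5 := by norm_num
    _ ≤ Real.exp 1 ^ 5 := by
        gcongr
        linarith [Real.exp_one_gt_d9]
    _ = Real.exp 5 := by rw [← Real.exp_nat_mul]; norm_num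
    _ ≤ _ := Real.exp_le_exp.2 (by linarith)

lemma apPlusConst_le {w : ℝ → ℝ} (hw : w ∈ AInftyPlus) {p : ℝ}
    (hp : Real.exp (35 * (aInftyPlusConst w).toReal) < p) :
    apPlusConst p w ≤
      ENNReal.ofReal (Real.exp (Real.exp (35 * (aInftyPlusConst w).toReal))) := by
  refine iSup_le fun a => iSup_le fun b => iSup_le fun c => iSup_le fun hab => iSup_le fun hbc => ?_
  -- Here the convention `0 * ∞ = 0` applies; in the other case the positive mass forces `C ≥ 1`.
  by_cases hm : mass w a b = 0
  · simp [hm]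
  set C := (aInftyPlusConst w).toReal with hCdef
  have hCeq : aInftyPlusConst w = ENNReal.ofReal C := (ENNReal.ofReal_toReal hw.2.ne).symm
  have hC1 : 1 ≤ C := by
    have := one_le_aInftyPlusConst hw hab hm
    rwa [hCeq, ENNReal.one_le_ofReal] at this
  obtain ⟨n, hn, hn'⟩ : ∃ n : ℕ, 8 * C ≤ n + 1 ∧ (n : ℝ) ≤ 8 * C + 1 :=
    ⟨⌈8 * C⌉₊, by linarith [Nat.le_ceil (8 * C)], (Nat.ceil_lt_add_one (by positivity)).le⟩
  set D := 2 ^ (n + 5) * C with hD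
  have hD0 : 0 < D := by positivity
  have hDle : D ≤ Real.exp (15 * C) := two_pow_mul_le_exp hC1 hn'
  have h80 := eighty_le_exp hC1
  have h1exp : 1 ≤ Real.exp (15 * C) := Real.one_le_exp (by positivity)
  -- This fixes the constant: `35 = 5 + 2 * 15`.
  have hsq : 80 * D ^ 2 ≤ Real.exp (35 * C) :=
    calc 80 * D ^ 2 ≤ Real.exp (5 * C) * Real.exp (15 * C) ^ 2 := by gcongr
      _ = Real.exp (35 * C) := by
          rw [← Real.exp_nat_mul, ← Real.exp_add]
          congr 1
          push_cast
          ring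
  have hpD : 1 + 8 * D ≤ p := by
    refine le_trans ?_ hp.le
    calc 1 + 8 * D ≤ 80 * Real.exp (15 * C) := by linarith
      _ ≤ Real.exp (5 * C) * Real.exp (15 * C) := by gcongr
      _ = Real.exp (20 * C) := by rw [← Real.exp_add]; congr 1; ring
      _ ≤ Real.exp (35 * C) := Real.exp_le_exp.2 (by linarith)
  have key := mass_mul_rpow_le hw hC1 hCeq hn (δ := 1 / D) rfl (p := p)
    (by rwa [div_div_eq_mul_div, div_one]) hab hbc hm
  rw [div_div_eq_mul_div, div_div_eq_mul_div, div_one, div_one] at key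
  exact key.trans (ENNReal.ofReal_le_ofReal
    ((rpow_self_le_exp hD0).trans (Real.exp_le_exp.2 hsq)))

end OneSided

theorem corollary1p3 :
    ∃ c : ℝ, 0 < c ∧
      ∀ w : ℝ → ℝ, w ∈ OneSided.AInftyPlus →
        ∀ p : ℝ, Real.exp (c * (OneSided.aInftyPlusConst w).toReal) < p →
          w ∈ OneSided.APPlus p ∧
            OneSided.apPlusConst p w ≤
              ENNReal.ofReal (Real.exp (Real.exp (c * (OneSided.aInftyPlusConst w).toReal))) := by
  refine ⟨35, by norm_num, fun w hw p hp => ?_⟩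
  have h := OneSided.apPlusConst_le hw hp
  exact ⟨⟨hw.1, h.trans_lt ENNReal.ofReal_lt_top⟩, h⟩
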